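/- Let $G$ be a locally compact, second countable Hausdorff group acting measurably on a measurable space $\mathcal X$ and on a standard Borel space $\mathcal Z$, and acting measurably by bounded linear operators (for instance through an orthogonal representation) on a separable real Hilbert space $\mathcal Y$. Here a measurable action is one for which $(g,w)\mapsto gw$ is jointly measurable. Let $X,Y,Z$ be random variables on one probability space with values in $\mathcal X,\mathcal Y,\mathcal Z$ respectively, and suppose that: (i) the distribution $P_X$ of $X$ is $G$-invariant; (ii) $P_{Y|X}$ is equivariant, that is, for every $g\in G$ one has $P_{Y|X=gx}=g\cdot P_{Y|X=x}$ for $P_X$-almost every $x$, where $g\cdot$ denotes push-forward under $g$; and $\mathbb E[\|Y\|^2]<\infty$; (iii) $P_{Z|X}$ is equivariant in the same sense, and $G$ acts freely on $\mathcal Z$ up to a set of zero probability, that is, $P_Z$-almost every $z$ has trivial stabilizer; (iv) the injected noise $Z$ is conditionally independent of the target $Y$ given $X$. Let $f:\mathcal X\times\mathcal Z\to\mathcal Y$ be a stochastic model with prediction $\hat Y=f(X,Z)$ and $\mathbb E[\|\hat Y\|^2]<\infty$, that is, $f\in L^2(P_{X,Z})$, where $P_{X,Z}$ is the joint distribution of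 $(X,Z)$. Then $f$ decomposes as $f=\bar f+f^\perp$, where $\bar f\in L^2(P_{X,Z})$ is measurable and jointly equivariant, $\bar f(gx,gz)=g\bar f(x,z)$ for all $g\in G$, $x\in\mathcal X$, $z\in\mathcal Z$, and where $f^\perp=f-\bar f$ is orthogonal to every jointly equivariant function of $L^2(P_{X,Z})$, in particular to $\bar f$, for the inner product $\langle f_1,f_2\rangle_{P_{X,Z}}=\int\langle f_1(x,z),f_2(x,z)\rangle_{\mathcal Y}\,P_{X,Z}(dx,dz)$. For every such decomposition, the risk $R(h)=\mathbb E[\|h(X,Z)-Y\|^2]$ satisfies $$R(f)-R(\bar f)=\|f^\perp\|_{P_{X,Z}}^2=\int\|f^\perp(x,z)\|^2\,P_{X,Z}(dx,dz).$$ -/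

import Mathlib

open MeasureTheory ProbabilityTheory

noncomputable section

/-- The conditional distribution `P(Y | X)` is `G`-equivariant: `P(Y | X = g x) = g · P(Y | X = x)`,
where `g` acts on measures by push-forward. A conditional distribution is only determined up to
`P_X`-null sets, so for each `g` the identity is required for `P_X`-almost every `x`; when `P_X` is
`G`-invariant this does not depend on the version, and it holds as soon as some version satisfies
the identity for all `g` and `x`. -/
def EquivariantCondDistrib (G : Type*) {Ω 𝒳 𝒴 : Type*} [MeasurableSpace Ω]
    [MeasurableSpace 𝒳] [MeasurableSpace 𝒴] [StandardBorelSpace 𝒴] [Nonempty 𝒴]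
    [SMul G 𝒳] [SMul G 𝒴]
    (μ : Measure Ω) [IsFiniteMeasure μ] (X : Ω → 𝒳) (Y : Ω → 𝒴) : Prop :=
  ∀ g : G, ∀ᵐ x ∂(μ.map X),
    condDistrib Y X μ (g • x) = (condDistrib Y X μ x).map (fun y => g • y)

/-- `Y` and `Z` are conditionally independent given `X`:
`P(Y, Z | X = x) = P(Y | X = x) ⊗ P(Z | X = x)` for `P_X`-almost every `x`. -/
def CondIndepGiven {Ω 𝒳 𝒴 𝒵 : Type*} [MeasurableSpace Ω] [MeasurableSpace 𝒳]
    [MeasurableSpace 𝒴] [StandardBorelSpace 𝒴] [Nonempty 𝒴]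
    [MeasurableSpace 𝒵] [StandardBorelSpace 𝒵] [Nonempty 𝒵]
    (μ : Measure Ω) [IsFiniteMeasure μ] (X : Ω → 𝒳) (Y : Ω → 𝒴) (Z : Ω → 𝒵) : Prop :=
  ∀ᵐ x ∂(μ.map X), condDistrib (fun ω => (Y ω, Z ω)) X μ x
    = (condDistrib Y X μ x).prod (condDistrib Z X μ x)

/-- `G` acts freely on the space up to a `ν`-null set: almost every point has trivial stabilizer. -/
def EssentiallyFree (G : Type*) {𝒵 : Type*} [Group G] [MulAction G 𝒵] [MeasurableSpace 𝒵]
    (ν : Measure 𝒵) : Prop :=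
  ∀ᵐ z ∂ν, MulAction.stabilizer G z = ⊥

/-- `h : 𝒳 × 𝒵 → 𝒴` is jointly equivariant: `h (g x, g z) = g h (x, z)`. -/
def JointlyEquivariant (G : Type*) {𝒳 𝒵 𝒴 : Type*} [SMul G 𝒳] [SMul G 𝒵] [SMul G 𝒴]
    (h : 𝒳 × 𝒵 → 𝒴) : Prop :=
  ∀ (g : G) (x : 𝒳) (z : 𝒵), h (g • x, g • z) = g • h (x, z)

/-- `fbar` is the jointly equivariant part of `f` in `L²(P)`: it is a measurable, square-integrable,
jointly equivariant function, and `f - fbar` is orthogonal in `L²(P)` to `fbar` and to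
every other jointly equivariant square-integrable function. -/
structure IsEquivariantPart (G : Type*) {𝒳 𝒵 𝒴 : Type*} [MeasurableSpace 𝒳] [MeasurableSpace 𝒵]
    [NormedAddCommGroup 𝒴] [InnerProductSpace ℝ 𝒴] [MeasurableSpace 𝒴]
    [SMul G 𝒳] [SMul G 𝒵] [SMul G 𝒴]
    (P : Measure (𝒳 × 𝒵)) (f fbar : 𝒳 × 𝒵 → 𝒴) : Prop where
  measurable : Measurable fbar
  memLp : MemLp fbar 2 P
  equivariant : JointlyEquivariant G fbar
  orthogonal : ∀ h : 𝒳 × 𝒵 → 𝒴, MemLp h 2 P → JointlyEquivariant G h →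
    ∫ p, inner ℝ (h p) (f p - fbar p) ∂P = 0

/-- The squared-error risk `R(f) = E ‖f(X, Z) - Y‖²`. -/
def risk {Ω 𝒳 𝒵 𝒴 : Type*} [MeasurableSpace Ω] [NormedAddCommGroup 𝒴]
    (μ : Measure Ω) (X : Ω → 𝒳) (Z : Ω → 𝒵) (Y : Ω → 𝒴) (f : 𝒳 × 𝒵 → 𝒴) : ℝ :=
  ∫ ω, ‖f (X ω, Z ω) - Y ω‖ ^ 2 ∂μ

end

/-! The risk gap is a Pythagoras identity. Write `d = f - fbar`; expanding squares gives `R(f) -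
R(fbar) = ‖d‖² + 2⟨d, fbar⟩ - 2 E⟨d(X,Z), Y⟩`, and the second term vanishes by orthogonality. By
conditional independence `Y` may be replaced in the third by its conditional mean given `X`, viewed
as a function of `(x, z)`. Equivariance of `P(Y | X)` makes that mean equivariant almost everywhere,
so this term should vanish by orthogonality too.

Existence of `fbar` is orthogonal projection in `L²(P)` onto the almost equivariant classes, a
closed subspace since the law `P` of `(X, Z)` is invariant. Both halves meet the same gap:
equivariance is known for each `g` off a null set depending on `g`, but required everywhere.
`AlmostEquivariant.exists_equivariant_ae_eq` closes it by averaging over the group. -/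

/-- The action of a group element by a bounded linear operator. -/
def groupSMulCLM {G : Type*} [Group G] (E : Type*) [NormedAddCommGroup E] [NormedSpace ℝ E]
    [DistribMulAction G E] [SMulCommClass G ℝ E] [ContinuousConstSMul G E] (g : G) : E →L[ℝ] E where
  toFun y := g • y
  map_add' := smul_add g
  map_smul' r y := smul_comm g r y
  cont := continuous_const_smul g

/-! ### From almost everywhere to exact equivariance. -/

section EquivariantVersion

/-- `u` is equivariant under each group element almost everywhere. -/
def AlmostEquivariant (G : Type*) [Group G] {E : Type*} [SMul G E] {α : Type*}
    [MeasurableSpace α] [MulAction G α] (P : Measure α) (u : α → E) : Prop :=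
  ∀ g : G, ∀ᵐ p ∂P, u (g • p) = g • u p

variable {G : Type*} [Group G] {E : Type*} [NormedAddCommGroup E] [DistribMulAction G E]
  {α : Type*} [MeasurableSpace α] [MulAction G α]

lemma AlmostEquivariant.congr [MeasurableConstSMul G α] {P : Measure α}
    [SMulInvariantMeasure G α P] {u v : α → E} (hu : AlmostEquivariant G P u) (huv : u =ᵐ[P] v) :
    AlmostEquivariant G P v := by
  intro g
  filter_upwards [hu g, huv, (measurePreserving_smul g P).quasiMeasurePreserving.ae huv]
    with p h1 h2 h3
  rw [← h3, h1, h2]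

variable [MeasurableSpace G] [MeasurableSpace E]

/-- An almost equivariant measurable function agrees almost everywhere with a measurable function
that is equivariant everywhere. -/
theorem AlmostEquivariant.exists_equivariant_ae_eq
    [TopologicalSpace G] [IsTopologicalGroup G]
    [LocallyCompactSpace G] [SecondCountableTopology G] [BorelSpace G]
    [MeasurableSMul₂ G α] [NormedSpace ℝ E] [CompleteSpace E] [SecondCountableTopology E] [BorelSpace E]
    [MeasurableSMul₂ G E] {P : Measure α} [SFinite P] {u : α → E} (hum : Measurable u)
    (hu : AlmostEquivariant G P u) :
    ∃ v : α → E, Measurable v ∧ (∀ (g : G) p, v (g • p) = g • v p) ∧ u =ᵐ[P] v := by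
  -- A probability measure with the null sets of Haar measure: constants average to themselves, and
  -- right translations preserve null sets.
  let m : Measure G := (Measure.haar : Measure G).toFinite
  have hm (k : G) : Measure.QuasiMeasurePreserving (fun g : G => g * k) m m :=
    (quasiMeasurePreserving_mul_right (Measure.haar : Measure G) k).mono
      (toFinite_absolutelyContinuous _) (absolutelyContinuous_toFinite _)
  let φ : α → G → E := fun p g => g⁻¹ • u (g • p)
  have hφ : Measurable (fun q : α × G => φ q.1 q.2) :=
    measurable_snd.inv.smul (hum.comp (measurable_snd.smul measurable_fst))
  let v : α → E := fun p => ∫ g, φ p g ∂m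
  have hv : Measurable v := (hφ.stronglyMeasurable.integral_prod_right').measurable
  have hset : MeasurableSet {q : α × G | φ q.1 q.2 = v q.1} :=
    measurableSet_eq_fun hφ (hv.comp measurable_fst)
  -- The points where `φ p` is almost everywhere constant, `v p` being then the constant. Unlike the
  -- set where `u` itself behaves well, `S` is exactly invariant.
  let S : Set α := {p | ∀ᵐ g ∂m, φ p g = v p}
  have hS : MeasurableSet S := by
    have := measurable_measure_prodMk_left (ν := m) hset.compl
    exact this (measurableSet_singleton 0)
  have hvc {p : α} {c : E} (h : ∀ᵐ g ∂m, φ p g = c) : v p = c := by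
    change ∫ g, φ p g ∂m = c
    rw [integral_congr_ae h]
    simp
  have hSk (k : G) {p : α} (hp : p ∈ S) : ∀ᵐ g ∂m, φ (k • p) g = k • v p := by
    -- The cocycle identity `φ (k • p) g = k • φ p (g * k)`.
    filter_upwards [(hm k).ae hp] with g hg
    rw [← hg]
    simp [φ, mul_smul]
  have hmem (k : G) {p : α} (hp : p ∈ S) : k • p ∈ S := by
    change ∀ᵐ g ∂m, φ (k • p) g = v (k • p)
    rw [hvc (hSk k hp)]
    exact hSk k hp
  refine ⟨S.indicator v, hv.indicator hS, fun k p => ?_, ?_⟩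
  · by_cases hp : p ∈ S
    · rw [Set.indicator_of_mem hp, Set.indicator_of_mem (hmem k hp), hvc (hSk k hp)]
    · have hkp : k • p ∉ S := fun h => hp (by simpa using hmem k⁻¹ h)
      rw [Set.indicator_of_notMem hp, Set.indicator_of_notMem hkp, smul_zero]
  · have hset' : MeasurableSet {q : α × G | φ q.1 q.2 = u q.1} :=
      measurableSet_eq_fun hφ (hum.comp measurable_fst)
    have hae : ∀ᵐ p ∂P, ∀ᵐ g ∂m, φ p g = u p := by
      -- Fubini trades "for each `g`, almost every `p`" for "for almost every `p`, almost every
      -- `g`", so `S` has full measure.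
      rw [Measure.ae_ae_comm hset']
      filter_upwards with g
      filter_upwards [hu g] with p hp
      simp [φ, hp]
    filter_upwards [hae] with p hp
    have hpS : p ∈ S := by
      change ∀ᵐ g ∂m, φ p g = v p
      rw [hvc hp]
      exact hp
    rw [Set.indicator_of_mem hpS, hvc hp]

end EquivariantVersion

/-! ### The closed subspace to project onto. -/

section Projection

open scoped ENNReal

variable (G : Type*) [Group G] (E : Type*) [NormedAddCommGroup E] [InnerProductSpace ℝ E]
  [DistribMulAction G E] [SMulCommClass G ℝ E] [ContinuousConstSMul G E]
  {α : Type*} [MeasurableSpace α] [MulAction G α] [MeasurableConstSMul G α]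
  (P : Measure α) [SMulInvariantMeasure G α P]

/-- The closed subspace of almost equivariant functions in `L²(P)`. -/
noncomputable def equivariantSubspace : Submodule ℝ (Lp E 2 P) :=
  ⨅ g : G, LinearMap.ker
    (((Lp.compMeasurePreservingₗᵢ ℝ (g • ·) (measurePreserving_smul g P)).toContinuousLinearMap
      - (groupSMulCLM E g).compLpL 2 P : Lp E 2 P →L[ℝ] Lp E 2 P) : Lp E 2 P →ₗ[ℝ] Lp E 2 P)

lemma isClosed_equivariantSubspace :
    IsClosed (equivariantSubspace G E P : Set (Lp E 2 P)) := by
  rw [equivariantSubspace, Submodule.coe_iInf]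
  exact isClosed_iInter fun g => ContinuousLinearMap.isClosed_ker _

variable {G E P}

lemma mem_equivariantSubspace_iff {u : Lp E 2 P} :
    u ∈ equivariantSubspace G E P ↔ AlmostEquivariant G P u := by
  simp only [equivariantSubspace, Submodule.mem_iInf, LinearMap.mem_ker]
  refine forall_congr' fun g => ?_
  change Lp.compMeasurePreserving (g • ·) (measurePreserving_smul g P) u
    - (groupSMulCLM E g).compLp u = 0 ↔ _
  rw [sub_eq_zero, Lp.ext_iff]
  have h1 := Lp.coeFn_compMeasurePreserving u (measurePreserving_smul g P)
  have h2 := (groupSMulCLM E g).coeFn_compLp' u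
  constructor <;> intro h
  · filter_upwards [h1, h2, h] with p a b c
    rw [a, b] at c
    exact c
  · filter_upwards [h1, h2, h] with p a b c
    rw [a, b]
    exact c

end Projection

/-- The inner product of two square-integrable functions is integrable. -/
lemma integrable_inner_of_memLp_two {α E : Type*} [MeasurableSpace α] [NormedAddCommGroup E]
    [InnerProductSpace ℝ E] {μ : Measure α} {f g : α → E} (hf : MemLp f 2 μ) (hg : MemLp g 2 μ) :
    Integrable (fun a => inner ℝ (f a) (g a)) μ :=
  (hf.norm.integrable_mul hg.norm).mono' (hf.1.inner hg.1)
    (Filter.Eventually.of_forall fun _ => norm_inner_le_norm _ _)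

/-! ### Conditional laws, the invariant joint law and the conditional mean. -/

section Disintegration

variable {G Ω 𝒳 𝒴 𝒵 : Type*} [MeasurableSpace Ω] [MeasurableSpace 𝒳]
  {μ : Measure Ω} [IsFiniteMeasure μ] {X : Ω → 𝒳}

/-- If the law of `X` is invariant and `P(Z | X)` is equivariant, the joint law of `(X, Z)` is
invariant under the diagonal action. -/
lemma EquivariantCondDistrib.smulInvariantMeasure_map_prodMk [MeasurableSpace 𝒵]
    [StandardBorelSpace 𝒵] [Nonempty 𝒵] [SMul G 𝒳] [SMul G 𝒵]
    [MeasurableConstSMul G 𝒳] [MeasurableConstSMul G 𝒵] {Z : Ω → 𝒵}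
    (hZ : Measurable Z) (hXinv : SMulInvariantMeasure G 𝒳 (μ.map X))
    (hZX : EquivariantCondDistrib G μ X Z) :
    SMulInvariantMeasure G (𝒳 × 𝒵) (μ.map (fun ω => (X ω, Z ω))) := by
  refine ⟨fun g s hs => ?_⟩
  rw [← compProd_map_condDistrib hZ.aemeasurable]
  have hg : Measurable (fun p : 𝒳 × 𝒵 => g • p) :=
    (measurable_fst.const_smul g).prodMk (measurable_snd.const_smul g)
  rw [Measure.compProd_apply (hg hs), Measure.compProd_apply hs]
  have hmeas := Kernel.measurable_kernel_prodMk_left (κ := condDistrib Z X μ) hs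
  -- Substituting `g • x` for `x` on one side only lets the equivariance of the kernel match the two
  -- integrands.
  rw [← (measurePreserving_smul g (μ.map X)).lintegral_comp hmeas]
  refine lintegral_congr_ae ?_
  filter_upwards [hZX g] with x hx
  rw [hx, Measure.map_apply (measurable_const_smul g) (measurable_prodMk_left hs)]
  rfl

lemma ae_integrable_condDistrib [NormedAddCommGroup 𝒴] [CompleteSpace 𝒴]
    [SecondCountableTopology 𝒴] [MeasurableSpace 𝒴] [BorelSpace 𝒴] {Y : Ω → 𝒴}
    (hX : Measurable X) (hY : Integrable Y μ) :
    ∀ᵐ x ∂(μ.map X), Integrable (fun y => y) (condDistrib Y X μ x) := by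
  have h : Integrable (fun p : 𝒳 × 𝒴 => p.2) (μ.map (fun ω => (X ω, Y ω))) :=
    (integrable_map_measure measurable_snd.aestronglyMeasurable
      (hX.aemeasurable.prodMk hY.aemeasurable)).2 hY
  exact h.condDistrib_ae_map hY.aemeasurable

variable [NormedAddCommGroup 𝒴] [InnerProductSpace ℝ 𝒴] [CompleteSpace 𝒴]
  [SecondCountableTopology 𝒴] [MeasurableSpace 𝒴] [BorelSpace 𝒴] {Y : Ω → 𝒴}

/-- The conditional mean of `Y` given `X`, as a function on the values of `X`. -/
noncomputable def condMean (μ : Measure Ω) [IsFiniteMeasure μ] (X : Ω → 𝒳) (Y : Ω → 𝒴) (x : 𝒳) : 𝒴 :=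
  ∫ y, y ∂(condDistrib Y X μ x)

lemma measurable_condMean : Measurable (condMean μ X Y) :=
  ((measurable_snd.stronglyMeasurable (f := fun p : 𝒳 × 𝒴 => p.2)).integral_condDistrib).measurable

/-- The composite is a version of `E[Y | X]`, and conditional expectation preserves `L²`. -/
lemma memLp_condMean_comp (hX : Measurable X) (hY : MemLp Y 2 μ) :
    MemLp (fun ω => condMean μ X Y (X ω)) 2 μ :=
  (hY.condExp one_le_two).ae_eq
    (condExp_ae_eq_integral_condDistrib' hX (hY.integrable one_le_two))

/-- A bounded linear operator commutes with the Bochner integral, so the mean of a pushed-forward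
law is the image of the mean. -/
lemma EquivariantCondDistrib.almostEquivariant_condMean [Group G] [MulAction G 𝒳]
    [DistribMulAction G 𝒴] [SMulCommClass G ℝ 𝒴] [ContinuousConstSMul G 𝒴]
    (hX : Measurable X) (hY : Integrable Y μ)
    (hYX : EquivariantCondDistrib G μ X Y) :
    AlmostEquivariant G (μ.map X) (condMean μ X Y) := by
  intro g
  filter_upwards [hYX g, ae_integrable_condDistrib hX hY] with x hx hint
  rw [condMean, hx, integral_map (f := fun y => y)
    (continuous_const_smul g).measurable.aemeasurable aestronglyMeasurable_id]
  exact (groupSMulCLM 𝒴 g).integral_comp_comm hint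

/-- Testing `Y` against a function of `(X, Z)` only sees the conditional mean of `Y` given `X`,
when `Y` and `Z` are conditionally independent given `X`. -/
lemma CondIndepGiven.integral_inner_eq_integral_inner_condMean [MeasurableSpace 𝒵]
    [StandardBorelSpace 𝒵] [Nonempty 𝒵] {Z : Ω → 𝒵} (hX : Measurable X) (hYm : Measurable Y)
    (hZ : Measurable Z) (hY : MemLp Y 2 μ) (hYZ : CondIndepGiven μ X Y Z)
    {d : 𝒳 × 𝒵 → 𝒴} (hd : MemLp d 2 (μ.map (fun ω => (X ω, Z ω)))) :
    ∫ ω, inner ℝ (d (X ω, Z ω)) (Y ω) ∂μ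
      = ∫ p, inner ℝ (d p) (condMean μ X Y p.1) ∂(μ.map (fun ω => (X ω, Z ω))) := by
  have hXZ : Measurable (fun ω => (X ω, Z ω)) := hX.prodMk hZ
  wlog hdm : StronglyMeasurable d generalizing d
  · obtain ⟨d', hd'm, hdd'⟩ := hd.1
    have h := this (hd.ae_eq hdd') hd'm
    rw [integral_congr_ae (g := fun ω => inner ℝ (d' (X ω, Z ω)) (Y ω)), h]
    · refine integral_congr_ae ?_
      filter_upwards [hdd'] with p hp
      rw [hp]
    · filter_upwards [ae_of_ae_map hXZ.aemeasurable hdd'] with ω hω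
      rw [hω]
  have hYZm : Measurable (fun ω => (Y ω, Z ω)) := hYm.prodMk hZ
  have hdX : MemLp (fun ω => d (X ω, Z ω)) 2 μ := hd.comp_of_map hXZ.aemeasurable
  let F : 𝒳 × 𝒴 × 𝒵 → ℝ := fun q => inner ℝ (d (q.1, q.2.2)) q.2.1
  have hFm : StronglyMeasurable F :=
    (hdm.comp_measurable (measurable_fst.prodMk measurable_snd.snd)).inner
      measurable_snd.fst.stronglyMeasurable
  have hFint : Integrable F (μ.map X ⊗ₘ condDistrib (fun ω => (Y ω, Z ω)) X μ) := by
    rw [compProd_map_condDistrib hYZm.aemeasurable,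
      integrable_map_measure hFm.aestronglyMeasurable (hX.prodMk hYZm).aemeasurable]
    exact integrable_inner_of_memLp_two hdX hY
  let H : 𝒳 × 𝒵 → ℝ := fun p => inner ℝ (d p) (condMean μ X Y p.1)
  have hHm : StronglyMeasurable H :=
    hdm.inner (measurable_condMean.comp measurable_fst).stronglyMeasurable
  have hHint : Integrable H (μ.map X ⊗ₘ condDistrib Z X μ) := by
    rw [compProd_map_condDistrib hZ.aemeasurable,
      integrable_map_measure hHm.aestronglyMeasurable hXZ.aemeasurable]
    exact integrable_inner_of_memLp_two hdX (memLp_condMean_comp hX hY)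
  calc ∫ ω, inner ℝ (d (X ω, Z ω)) (Y ω) ∂μ
      = ∫ q, F q ∂(μ.map X ⊗ₘ condDistrib (fun ω => (Y ω, Z ω)) X μ) := by
        rw [compProd_map_condDistrib hYZm.aemeasurable,
          integral_map (hX.prodMk hYZm).aemeasurable hFm.aestronglyMeasurable]
    _ = ∫ p, H p ∂(μ.map X ⊗ₘ condDistrib Z X μ) := by
        rw [Measure.integral_compProd hFint, Measure.integral_compProd hHint]
        refine integral_congr_ae ?_
        filter_upwards [hYZ, ((Measure.integrable_compProd_iff hFm.aestronglyMeasurable).1 hFint).1,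
          ae_integrable_condDistrib hX (hY.integrable one_le_two)] with x hx hFx hYx
        rw [hx] at hFx
        change ∫ yz, F (x, yz) ∂_ = ∫ z, H (x, z) ∂_
        -- Given `X = x` the law of `(Y, Z)` is a product; integrating over `y` first puts the
        -- conditional mean inside the inner product.
        rw [hx, integral_prod_symm _ hFx]
        refine integral_congr_ae (Filter.Eventually.of_forall fun z => ?_)
        exact integral_inner hYx (d (x, z))
    _ = _ := by rw [compProd_map_condDistrib hZ.aemeasurable]

end Disintegration

/-! ### Existence of the decomposition and the risk identity. -/

theorem mainTheorem5
    {G : Type*} [Group G] [TopologicalSpace G] [IsTopologicalGroup G] [LocallyCompactSpace G]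
    [SecondCountableTopology G] [T2Space G] [MeasurableSpace G] [BorelSpace G]
    {𝒳 : Type*} [MeasurableSpace 𝒳] [MulAction G 𝒳] [MeasurableSMul₂ G 𝒳]
    {𝒵 : Type*} [MeasurableSpace 𝒵] [StandardBorelSpace 𝒵] [Nonempty 𝒵]
    [MulAction G 𝒵] [MeasurableSMul₂ G 𝒵]
    {𝒴 : Type*} [NormedAddCommGroup 𝒴] [InnerProductSpace ℝ 𝒴] [CompleteSpace 𝒴]
    [SecondCountableTopology 𝒴] [MeasurableSpace 𝒴] [BorelSpace 𝒴]
    [DistribMulAction G 𝒴] [SMulCommClass G ℝ 𝒴] [ContinuousConstSMul G 𝒴] [MeasurableSMul₂ G 𝒴]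
    {Ω : Type*} [MeasurableSpace Ω] (μ : Measure Ω) [IsProbabilityMeasure μ]
    (X : Ω → 𝒳) (Y : Ω → 𝒴) (Z : Ω → 𝒵)
    (hX : Measurable X) (hY : Measurable Y) (hZ : Measurable Z)
    (hXinv : SMulInvariantMeasure G 𝒳 (μ.map X))
    (hYX : EquivariantCondDistrib G μ X Y)
    (hY2 : MemLp Y 2 μ)
    (hZX : EquivariantCondDistrib G μ X Z)
    (hfree : EssentiallyFree G (μ.map Z))
    (hYZ : CondIndepGiven μ X Y Z)
    (f : 𝒳 × 𝒵 → 𝒴)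
    (hf2 : MemLp f 2 (μ.map (fun ω => (X ω, Z ω)))) :
    (∃ fbar : 𝒳 × 𝒵 → 𝒴, IsEquivariantPart G (μ.map (fun ω => (X ω, Z ω))) f fbar) ∧
    ∀ fbar : 𝒳 × 𝒵 → 𝒴, IsEquivariantPart G (μ.map (fun ω => (X ω, Z ω))) f fbar →
      ∫ p, inner ℝ (fbar p) (f p - fbar p) ∂(μ.map (fun ω => (X ω, Z ω))) = 0 ∧
      risk μ X Z Y f - risk μ X Z Y fbar
        = ∫ p, ‖f p - fbar p‖ ^ 2 ∂(μ.map (fun ω => (X ω, Z ω))) := by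
  set P := μ.map (fun ω => (X ω, Z ω)) with hP
  have hXZ : Measurable (fun ω => (X ω, Z ω)) := hX.prodMk hZ
  have : IsProbabilityMeasure P := Measure.isProbabilityMeasure_map hXZ.aemeasurable
  have hPinv : SMulInvariantMeasure G (𝒳 × 𝒵) P :=
    hZX.smulInvariantMeasure_map_prodMk hZ hXinv
  have : MeasurableSMul₂ G (𝒳 × 𝒵) :=
    ⟨(measurable_fst.smul measurable_snd.fst).prodMk (measurable_fst.smul measurable_snd.snd)⟩
  refine ⟨?_, fun fbar hfbar => ⟨hfbar.orthogonal fbar hfbar.memLp hfbar.equivariant, ?_⟩⟩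
  · let K := equivariantSubspace G 𝒴 P
    have : CompleteSpace K := (isClosed_equivariantSubspace G 𝒴 P).completeSpace_coe
    let u : Lp 𝒴 2 P := K.starProjection (hf2.toLp f)
    have huK : u ∈ K := K.starProjection_apply_mem _
    have hum := (Lp.stronglyMeasurable u).measurable
    -- The projection is only an almost equivariant class; `v` is an exactly equivariant
    -- representative.
    obtain ⟨v, hvm, hveq, huv⟩ :=
      (mem_equivariantSubspace_iff.1 huK).exists_equivariant_ae_eq hum
    refine ⟨v, hvm, (Lp.memLp u).ae_eq huv, fun g x z => hveq g (x, z), fun h hh heq => ?_⟩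
    have hhK : hh.toLp h ∈ K := mem_equivariantSubspace_iff.2
      (AlmostEquivariant.congr (fun g => Filter.Eventually.of_forall fun p => heq g p.1 p.2)
        hh.coeFn_toLp.symm)
    have horth := K.sub_starProjection_mem_orthogonal (hf2.toLp f) _ hhK
    rw [L2.inner_def] at horth
    rw [← horth]
    refine integral_congr_ae ?_
    filter_upwards [hh.coeFn_toLp, hf2.coeFn_toLp, huv, Lp.coeFn_sub (hf2.toLp f) u]
      with p h1 h2 h3 h4
    change _ = inner ℝ (hh.toLp h p) ((hf2.toLp f - u : Lp 𝒴 2 P) p)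
    rw [h4, Pi.sub_apply, h1, h2, h3]
  · have hd : MemLp (fun p => f p - fbar p) 2 P := hf2.sub hfbar.memLp
    have hy : MemLp (fun p : 𝒳 × 𝒵 => condMean μ X Y p.1) 2 P :=
      (memLp_map_measure_iff (measurable_condMean.comp measurable_fst).aestronglyMeasurable
        hXZ.aemeasurable).2 (memLp_condMean_comp hX hY2)
    have hyeq : AlmostEquivariant G P (fun p : 𝒳 × 𝒵 => condMean μ X Y p.1) := by
      have hfst : μ.map X = P.map Prod.fst := by
        rw [hP, Measure.map_map measurable_fst hXZ]
        rfl
      intro g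
      have := hYX.almostEquivariant_condMean hX (hY2.integrable one_le_two) g
      rw [hfst] at this
      exact ae_of_ae_map measurable_fst.aemeasurable this
    -- `hfbar.orthogonal` tests only against exactly equivariant functions, so the conditional mean
    -- is replaced by such a version `w`, which may depend on `z`.
    obtain ⟨w, -, hweq, hyw⟩ :=
      hyeq.exists_equivariant_ae_eq (measurable_condMean.comp measurable_fst)
    have hdY : ∫ ω, inner ℝ (f (X ω, Z ω) - fbar (X ω, Z ω)) (Y ω) ∂μ = 0 := by
      rw [hYZ.integral_inner_eq_integral_inner_condMean hX hY hZ hY2 hd,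
        ← hfbar.orthogonal w (hy.ae_eq hyw) (fun g x z => hweq g (x, z))]
      refine integral_congr_ae ?_
      filter_upwards [hyw] with p hp
      rw [← hp, real_inner_comm]
      rfl
    have hdf : ∫ ω, inner ℝ (fbar (X ω, Z ω)) (f (X ω, Z ω) - fbar (X ω, Z ω)) ∂μ = 0 := by
      rw [← hfbar.orthogonal fbar hfbar.memLp hfbar.equivariant,
        integral_map hXZ.aemeasurable (hfbar.memLp.1.inner hd.1)]
    have hf' : MemLp (fun ω => f (X ω, Z ω)) 2 μ := hf2.comp_of_map hXZ.aemeasurable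
    have hb' : MemLp (fun ω => fbar (X ω, Z ω)) 2 μ := hfbar.memLp.comp_of_map hXZ.aemeasurable
    have hd' : MemLp (fun ω => f (X ω, Z ω) - fbar (X ω, Z ω)) 2 μ := hf'.sub hb'
    have hsq {u : Ω → 𝒴} (hu : MemLp u 2 μ) : Integrable (fun ω => ‖u ω‖ ^ 2) μ :=
      hu.integrable_norm_pow two_ne_zero
    have i4 : Integrable (fun ω => ‖f (X ω, Z ω) - Y ω‖ ^ 2) μ := hsq (hf'.sub hY2)
    have i5 : Integrable (fun ω => ‖fbar (X ω, Z ω) - Y ω‖ ^ 2) μ := hsq (hb'.sub hY2)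
    rw [risk, risk, ← integral_sub i4 i5,
      integral_map (f := fun p => ‖f p - fbar p‖ ^ 2) hXZ.aemeasurable (hd.1.norm.pow 2)]
    have hexp : ∀ ω, ‖f (X ω, Z ω) - Y ω‖ ^ 2 - ‖fbar (X ω, Z ω) - Y ω‖ ^ 2
        = ‖f (X ω, Z ω) - fbar (X ω, Z ω)‖ ^ 2
          + 2 * inner ℝ (fbar (X ω, Z ω)) (f (X ω, Z ω) - fbar (X ω, Z ω))
          - 2 * inner ℝ (f (X ω, Z ω) - fbar (X ω, Z ω)) (Y ω) := by
      intro ω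
      have h : f (X ω, Z ω) - Y ω
          = (f (X ω, Z ω) - fbar (X ω, Z ω)) + (fbar (X ω, Z ω) - Y ω) := by abel
      rw [h, norm_add_sq_real, inner_sub_right, real_inner_comm (fbar (X ω, Z ω))]
      ring
    simp_rw [hexp]
    have i1 := hsq hd'
    have i2 := (integrable_inner_of_memLp_two hb' hd').const_mul 2
    have i3 := (integrable_inner_of_memLp_two hd' hY2).const_mul 2
    have i12 : Integrable (fun ω => ‖f (X ω, Z ω) - fbar (X ω, Z ω)‖ ^ 2
        + 2 * inner ℝ (fbar (X ω, Z ω)) (f (X ω, Z ω) - fbar (X ω, Z ω))) μ := i1.add i2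
    rw [integral_sub i12 i3, integral_add i1 i2, integral_const_mul, integral_const_mul,
      hdY, hdf]
    simp
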